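/- Write $e(G)$ for the number of edges of a finite simple graph $G$, let $T_r(m)$ denote the $m$-vertex Turán graph (the complete $r$-partite graph on $m$ vertices with part sizes as equal as possible, empty parts being allowed, so $T_r(m)=K_m$ if $m\le r$), and let $K_{a_1,\dots,a_k}$ denote the complete multipartite graph with parts of sizes $a_1,\dots,a_k$. A graph is Hamiltonian if it contains a Hamiltonian cycle, i.e. a cycle (of length at least $3$) through all its vertices. Let $r\ge 3$, and let $n\ge 26$ if $r=3$, $n\ge 11$ if $r=4$, and $n\ge 1$ if $r\ge 5$. If $G$ is an $n$-vertex, $K_{r+1}$-free graph that is not Hamiltonian, then $$e(G)\le e(T_r(n-1))+1 .$$ Moreover, an $n$-vertex graph $G$ is $K_{r+1}$-free, is not Hamiltonian and satisfies $e(G)=e(T_r(n-1))+1$ if and only if one of the following holds: 1. $G$ is $K_{r+1}$-free and consists of $T_r(n-1)$ plus a vertex of degree $1$ (that is, $G$ has a vertex $x$ of degree $1$ with $G-x\cong T_r(n-1)$); 2. $r\ge 5$, $n=5$ and $G\cong K_{3,1,1}$; 3. $r=4$, $n=11$ and $G\cong K_{6,2,2,1}$; 4. $r=5$, $n=7$ and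 $G\cong K_{4,1,1,1}$; 5. $r=5$, $n=9$ and $G\cong K_{5,1,1,1,1}$. -/

import Mathlib

/-- `G` contains a Hamiltonian cycle. In particular graphs on at most two vertices,
including the one-vertex graph, contain none. -/
def HasHamiltonianCycle {V : Type*} [DecidableEq V] (G : SimpleGraph V) : Prop :=
  ∃ (a : V) (p : G.Walk a a), p.IsHamiltonianCycle

/-- `G` is a `K_{r+1}`-free graph which consists of the Turán graph `T_r(n-1)`, where `n` is the
number of vertices of `G`, plus one vertex of degree `d`. -/
def IsTuranPlusVertex {V : Type*} [Fintype V] (G : SimpleGraph V) [DecidableRel G.Adj]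
    (r d : ℕ) : Prop :=
  G.CliqueFree (r + 1) ∧
    ∃ x : V, G.degree x = d ∧
      Nonempty (G.induce {v : V | v ≠ x} ≃g SimpleGraph.turanGraph (Fintype.card V - 1) r)

/-- The complete multipartite graph with `k` parts, of sizes `s 0, …, s (k - 1)`. -/
def multipartite {k : ℕ} (s : Fin k → ℕ) : SimpleGraph (Σ i : Fin k, Fin (s i)) :=
  SimpleGraph.completeMultipartiteGraph (fun i : Fin k => Fin (s i))

/-! By Chvátal's theorem, a non-Hamiltonian graph on n ≥ 3 vertices has some k < n/2 with at least k
vertices of degree ≤ k and at least n - k vertices of degree < n - k. Let S be k vertices of degree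
≤ k. At most k² edges meet S and Turán's theorem bounds the others, so e(G) ≤ k² + e(T_r(n-k))
(`card_edgeFinset_le_sq_add`).

A vertex of degree ≤ 1 gives the bound at once, with equality only for a Turán graph plus a pendant
vertex. For k ≥ 2, k² is compared with the growth of the Turán number from n - k to n - 1 vertices
(`mul_card_edgeFinset_turanGraph_add_le`). This settles r ≥ 4, where equality survives only for n =
2k + 1 and a few pairs (r, k). For r = 3 it is too weak when n - k is k + 1 or k + 2; there a vertex
of S with many neighbours outside S has a triangle-free neighbourhood, which costs enough edges
(`card_edgeFinset_lt_of_cliqueFree_four`).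

In the equality cases with n = 2k + 1, the second half of Chvátal's condition yields one more vertex
w ∉ S of degree ≤ k. Equality makes S independent, each of its vertices missing exactly one of the k
+ 1 outside vertices, and makes the outside T_r(k+1). The degree of w then forces the missed vertex
to be w, so G is the join of the independent set S ∪ {w} with T_r(k+1) - w. Conversely, a vertex of
degree 1, or an independent set on more than half of the vertices, excludes a Hamiltonian cycle. -/

namespace SimpleGraph

/-! ### Hamiltonian cycles as sequences: rotation and crossing chords -/

/-- The first `n` terms of `q` are distinct and form a cycle of `G`, in this order. -/
def IsCyclicSeq {V : Type*} (G : SimpleGraph V) (n : ℕ) (q : ℕ → V) : Prop :=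
  (∀ i < n, ∀ j < n, q i = q j → i = j) ∧ (∀ i, i + 1 < n → G.Adj (q i) (q (i + 1))) ∧
    G.Adj (q (n - 1)) (q 0)

/-- The walk along a sequence of consecutively adjacent vertices. -/
lemma exists_walk_support_eq_map_range {V : Type*} (G : SimpleGraph V) (q : ℕ → V) (k : ℕ)
    (hq : ∀ i < k, G.Adj (q i) (q (i + 1))) :
    ∃ p : G.Walk (q 0) (q k), p.support = (List.range (k + 1)).map q := by
  induction k with
  | zero => exact ⟨.nil, by simp⟩
  | succ k ih =>
    obtain ⟨p, hp⟩ := ih fun i hi => hq i (by omega)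
    refine ⟨p.concat (hq k (by omega)), ?_⟩
    rw [Walk.support_concat, hp, List.range_succ (n := k + 1)]
    simp

/-- Turns cutting and reversing of cycles into index arithmetic. -/
lemma hasHamiltonianCycle_iff_exists_isCyclicSeq {V : Type*} [Fintype V] [DecidableEq V]
    (G : SimpleGraph V) :
    HasHamiltonianCycle G ↔ 3 ≤ Fintype.card V ∧ ∃ q, G.IsCyclicSeq (Fintype.card V) q := by
  constructor
  · rintro ⟨a, p, hp⟩
    have hlen := hp.length_eq
    have h3 := hp.isCycle.three_le_length
    refine ⟨by omega, p.getVert, ?_, ?_, ?_⟩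
    · intro i hi j hj hij
      exact hp.isCycle.getVert_injOn' (by simp only [Set.mem_ofPred_eq]; omega)
        (by simp only [Set.mem_ofPred_eq]; omega) hij
    · intro i hi
      exact p.adj_getVert_succ (by omega)
    · have := p.adj_getVert_succ (i := Fintype.card V - 1) (by omega)
      rw [show Fintype.card V - 1 + 1 = p.length by omega, p.getVert_length] at this
      rwa [p.getVert_zero]
  · rintro ⟨h3, q, hinj, hadj, hlast⟩
    obtain ⟨p, hp⟩ := G.exists_walk_support_eq_map_range q (Fintype.card V - 1)
      fun i hi => hadj i (by omega)
    have hlen : p.length = Fintype.card V - 1 := by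
      have := congrArg List.length hp
      simp at this
      omega
    have hpath : p.IsPath := by
      rw [Walk.isPath_def, hp]
      refine List.Nodup.map_on ?_ List.nodup_range
      intro i hi j hj hij
      rw [List.mem_range] at hi hj
      exact hinj i (by omega) j (by omega) hij
    refine ⟨_, Walk.cons hlast p, ?_⟩
    rw [Walk.isHamiltonianCycle_iff_isCycle_and_length_eq, Walk.cons_isCycle_iff]
    refine ⟨⟨hpath, ?_⟩, by simp; omega⟩
    -- A path containing the edge between its own ends has length one, impossible with three
    -- vertices.
    intro he
    have hle := hpath.length_eq_one_of_mem_edges (Sym2.eq_swap ▸ he)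
    omega

lemma IsCyclicSeq.rotate {V : Type*} {G : SimpleGraph V} {n : ℕ} {q : ℕ → V}
    (hq : G.IsCyclicSeq n q) {i : ℕ} (hi : i < n) :
    G.IsCyclicSeq n fun x => if x + i < n then q (x + i) else q (x + i - n) := by
  obtain ⟨hinj, hadj, hlast⟩ := hq
  refine ⟨?_, ?_, ?_⟩
  · intro x hx y hy hxy
    dsimp only at hxy
    split_ifs at hxy <;> have := hinj _ (by omega) _ (by omega) hxy <;> omega
  · intro x hx
    dsimp only
    split_ifs with h1 h2 h2
    · have := hadj (x + i) (by omega)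
      rwa [show x + 1 + i = x + i + 1 by omega]
    · rw [show x + i = n - 1 by omega, show x + 1 + i - n = 0 by omega]
      exact hlast
    · omega
    · have := hadj (x + i - n) (by omega)
      rwa [show x + 1 + i - n = x + i - n + 1 by omega]
  · dsimp only
    split_ifs with h1 h2
    · rw [show n - 1 + i = n - 1 by omega, show 0 + i = 0 by omega]
      exact hlast
    · omega
    · have := hadj (n - 1 + i - n) (by omega)
      rwa [show n - 1 + i - n + 1 = 0 + i by omega] at this
    · omega

/-- Replacing the two chords `q 0, q (i + 1)` and `q i, q (n - 1)` of a path closes it up. -/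
lemma isCyclicSeq_of_crossing {V : Type*} {G : SimpleGraph V} {n : ℕ} {q : ℕ → V}
    (hinj : ∀ i < n, ∀ j < n, q i = q j → i = j)
    (hadj : ∀ i, i + 1 < n → G.Adj (q i) (q (i + 1))) {i : ℕ} (hi : i + 1 < n)
    (h0 : G.Adj (q 0) (q (i + 1))) (hl : G.Adj (q i) (q (n - 1))) :
    G.IsCyclicSeq n fun x => if x ≤ i then q x else q (n + i - x) := by
  refine ⟨?_, ?_, ?_⟩
  · intro x hx y hy hxy
    dsimp only at hxy
    split_ifs at hxy <;> have := hinj _ (by omega) _ (by omega) hxy <;> omega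
  · intro x hx
    dsimp only
    split_ifs with h1 h2 h2
    · exact hadj x hx
    · rw [show x = i by omega, show n + i - (i + 1) = n - 1 by omega]
      exact hl
    · omega
    · have := hadj (n + i - (x + 1)) (by omega)
      rw [show n + i - (x + 1) + 1 = n + i - x by omega] at this
      exact this.symm
  · dsimp only
    rw [if_neg (by omega), if_pos (by omega), show n + i - (n - 1) = i + 1 by omega]
    exact h0.symm

/-! ### Chvátal's degree condition -/

/-- In a maximal non-Hamiltonian graph, nonadjacent vertices are joined by a Hamiltonian path. -/
lemma exists_hamiltonian_path_of_maximal {V : Type*} [Fintype V] [DecidableEq V]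
    {G : SimpleGraph V} (hG : Maximal (fun H => ¬ HasHamiltonianCycle H) G) {u v : V}
    (huv : u ≠ v) (hnadj : ¬ G.Adj u v) :
    ∃ q : ℕ → V, (∀ i < Fintype.card V, ∀ j < Fintype.card V, q i = q j → i = j) ∧
      (∀ i, i + 1 < Fintype.card V → G.Adj (q i) (q (i + 1))) ∧
      ((q 0 = u ∧ q (Fintype.card V - 1) = v) ∨ (q 0 = v ∧ q (Fintype.card V - 1) = u)) := by
  have hham : HasHamiltonianCycle (G ⊔ edge u v) := by
    by_contra hno
    have hle : G ⊔ edge u v ≤ G := hG.2 hno le_sup_left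
    exact hnadj (hle (Or.inr (by simp [edge_adj, huv])))
  rw [hasHamiltonianCycle_iff_exists_isCyclicSeq] at hham
  obtain ⟨h3, q, hq⟩ := hham
  have hno : ¬ HasHamiltonianCycle G := hG.1
  rw [hasHamiltonianCycle_iff_exists_isCyclicSeq] at hno
  push Not at hno
  replace hno := hno h3
  generalize Fintype.card V = n at *
  -- The cycle must use the new edge; rotate it so that this is the closing edge.
  have key : ∃ q, (G ⊔ edge u v).IsCyclicSeq n q ∧ ¬ G.Adj (q (n - 1)) (q 0) := by
    by_cases hl : G.Adj (q (n - 1)) (q 0)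
    · have : ∃ i, i + 1 < n ∧ ¬ G.Adj (q i) (q (i + 1)) := by
        by_contra! hall
        exact hno q ⟨hq.1, hall, hl⟩
      obtain ⟨i, hi, hi'⟩ := this
      refine ⟨_, hq.rotate hi, ?_⟩
      rwa [if_neg (by omega), if_pos (by omega), zero_add,
        show n - 1 + (i + 1) - n = i by omega]
    · exact ⟨q, hq, hl⟩
  obtain ⟨q, ⟨hinj, hadj, hlast⟩, hl⟩ := key
  have hl' : (q 0 = u ∧ q (n - 1) = v) ∨ (q 0 = v ∧ q (n - 1) = u) := by
    have := hlast.resolve_left hl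
    rw [edge_adj] at this
    tauto
  refine ⟨q, hinj, ?_, hl'⟩
  intro i hi
  refine (hadj i hi).resolve_right ?_
  rw [edge_adj]
  -- By injectivity, the two ends of the sequence are not also consecutive in it, so no inner step
  -- uses the new edge.
  have e1 : ∀ j < n, q i = q j → i = j := hinj i (by omega)
  have e2 : ∀ j < n, q (i + 1) = q j → i + 1 = j := hinj (i + 1) (by omega)
  rintro ⟨⟨h1, h2⟩ | ⟨h1, h2⟩, -⟩ <;> rcases hl' with ⟨h4, h5⟩ | ⟨h4, h5⟩
  · have := e1 0 (by omega) (h1.trans h4.symm)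
    have := e2 (n - 1) (by omega) (h2.trans h5.symm)
    omega
  · have := e2 0 (by omega) (h2.trans h4.symm)
    omega
  · have := e2 0 (by omega) (h2.trans h4.symm)
    omega
  · have := e1 0 (by omega) (h1.trans h4.symm)
    have := e2 (n - 1) (by omega) (h2.trans h5.symm)
    omega

lemma hasHamiltonianCycle_top {V : Type*} [Fintype V] [DecidableEq V]
    (h3 : 3 ≤ Fintype.card V) : HasHamiltonianCycle (⊤ : SimpleGraph V) := by
  rw [hasHamiltonianCycle_iff_exists_isCyclicSeq]
  refine ⟨h3, fun i => (Fintype.equivFin V).symm ⟨i % Fintype.card V, Nat.mod_lt _ (by omega)⟩,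
    ?_⟩
  have hinj : ∀ i < Fintype.card V, ∀ j < Fintype.card V,
      (Fintype.equivFin V).symm ⟨i % Fintype.card V, Nat.mod_lt _ (by omega)⟩ =
      (Fintype.equivFin V).symm ⟨j % Fintype.card V, Nat.mod_lt _ (by omega)⟩ → i = j := by
    intro i hi j hj hij
    simpa [Nat.mod_eq_of_lt hi, Nat.mod_eq_of_lt hj] using hij
  refine ⟨hinj, fun i hi h => ?_, fun h => ?_⟩
  · have := hinj _ (by omega) _ (by omega) h
    omega
  · have := hinj _ (by omega) _ (by omega) h
    omega

/-- The degree condition of **Chvátal's theorem**, for a maximal non-Hamiltonian graph. -/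
lemma exists_degree_condition_of_maximal {V : Type*} [Fintype V] [DecidableEq V]
    {G : SimpleGraph V} [DecidableRel G.Adj] (h3 : 3 ≤ Fintype.card V)
    (hG : Maximal (fun H => ¬ HasHamiltonianCycle H) G) :
    ∃ k, 2 * k < Fintype.card V ∧ k ≤ (Finset.univ.filter fun v => G.degree v ≤ k).card ∧
      Fintype.card V - k ≤
        (Finset.univ.filter fun v => G.degree v < Fintype.card V - k).card ∧
      ∃ u, G.degree u ≤ k := by
  have hne : ∃ x : V × V, x.1 ≠ x.2 ∧ ¬ G.Adj x.1 x.2 := by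
    by_contra! hall
    have : G = ⊤ := by
      ext x y
      exact ⟨fun h => h.ne, fun h => hall (x, y) h⟩
    exact hG.1 (this ▸ hasHamiltonianCycle_top h3)
  obtain ⟨x₀, hx₀⟩ := hne
  -- A nonadjacent pair of maximal degree sum; k will be the smaller of the two degrees.
  obtain ⟨⟨u, v⟩, hmem, hmax⟩ := Finset.exists_max_image
    (Finset.univ.filter fun x : V × V => x.1 ≠ x.2 ∧ ¬ G.Adj x.1 x.2)
    (fun x => G.degree x.1 + G.degree x.2) ⟨x₀, by simpa using hx₀⟩
  simp only [Finset.mem_filter, Finset.mem_univ, true_and, Prod.forall, and_imp] at hmem hmax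
  obtain ⟨huv, hnadj⟩ := hmem
  wlog hle : G.degree u ≤ G.degree v generalizing u v
  · exact this v u (fun x y h1 h2 => by have := hmax x y h1 h2; omega) huv.symm
      (fun h => hnadj h.symm) (by omega)
  obtain ⟨q, hinj, hadj, hends⟩ : ∃ q : ℕ → V,
      (∀ i < Fintype.card V, ∀ j < Fintype.card V, q i = q j → i = j) ∧
      (∀ i, i + 1 < Fintype.card V → G.Adj (q i) (q (i + 1))) ∧
      (q 0 = u ∧ q (Fintype.card V - 1) = v) := by
    obtain ⟨q, hinj, hadj, hends | hends⟩ := exists_hamiltonian_path_of_maximal hG huv hnadj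
    · exact ⟨q, hinj, hadj, hends⟩
    · refine ⟨fun i => q (Fintype.card V - 1 - i), ?_, ?_, ?_, ?_⟩
      · intro i hi j hj hij
        have := hinj _ (by omega) _ (by omega) hij
        omega
      · intro i hi
        have := hadj (Fintype.card V - 1 - (i + 1)) (by omega)
        rw [show Fintype.card V - 1 - (i + 1) + 1 = Fintype.card V - 1 - i by omega] at this
        exact this.symm
      · exact hends.2
      · simpa using hends.1
  obtain ⟨hq0, hqn⟩ := hends
  have hsurj : ∀ x, ∃ i < Fintype.card V, q i = x := by
    intro x
    have : (Finset.range (Fintype.card V)).image q = Finset.univ := by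
      apply Finset.eq_univ_of_card
      rw [Finset.card_image_of_injOn, Finset.card_range]
      intro i hi j hj
      exact hinj i (by simpa using hi) j (by simpa using hj)
    have hx := this ▸ Finset.mem_univ x
    simpa using hx
  have hcross : ∀ i, i + 1 < Fintype.card V → G.Adj u (q (i + 1)) → ¬ G.Adj v (q i) := by
    intro i hi h1 h2
    apply hG.1
    rw [hasHamiltonianCycle_iff_exists_isCyclicSeq]
    exact ⟨h3, _, isCyclicSeq_of_crossing hinj hadj hi (hq0 ▸ h1) (hqn ▸ h2.symm)⟩
  -- Positions just before a neighbour of u on the path: there are deg u of them, and by `hcross`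
  -- none holds a neighbour of v.
  set A := (Finset.range (Fintype.card V - 1)).filter fun i => G.Adj u (q (i + 1)) with hA
  have hAdeg : A.card = G.degree u := by
    rw [← G.card_neighborFinset_eq_degree u, ← Finset.card_image_of_injOn (f := fun i => q (i + 1))]
    · congr 1
      ext x
      simp only [hA, Finset.mem_image, Finset.mem_filter, Finset.mem_range, mem_neighborFinset]
      constructor
      · rintro ⟨i, hi, rfl⟩
        exact hi.2
      · intro hx
        obtain ⟨j, hj, rfl⟩ := hsurj x
        have hj0 : j ≠ 0 := by
          rintro rfl
          exact hx.ne hq0.symm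
        exact ⟨j - 1, ⟨by omega, by rwa [show j - 1 + 1 = j by omega]⟩,
          by rw [show j - 1 + 1 = j by omega]⟩
    · intro i hi j hj hij
      simp only [hA, Finset.coe_filter, Finset.mem_range, Set.mem_ofPred_eq] at hi hj
      have := hinj (i + 1) (by omega) (j + 1) (by omega) hij
      omega
  have hBinj : Set.InjOn q (Finset.range (Fintype.card V - 1) : Set ℕ) := by
    intro i hi j hj hij
    simp only [Finset.coe_range, Set.mem_Iio] at hi hj
    exact hinj i (by omega) j (by omega) hij
  have hdv : G.degree v ≤ Fintype.card V - 1 - G.degree u := by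
    have hsub : G.neighborFinset v ⊆ ((Finset.range (Fintype.card V - 1)) \ A).image q := by
      intro x hx
      rw [mem_neighborFinset] at hx
      obtain ⟨j, hj, rfl⟩ := hsurj x
      have hj1 : j ≠ Fintype.card V - 1 := by
        rintro rfl
        exact hx.ne hqn.symm
      refine Finset.mem_image_of_mem _ ?_
      simp only [hA, Finset.mem_sdiff, Finset.mem_range, Finset.mem_filter, not_and]
      exact ⟨by omega, fun _ h => hcross j (by omega) h hx⟩
    have h1 := Finset.card_le_card hsub
    have h2 := Finset.card_image_le (f := q) (s := (Finset.range (Fintype.card V - 1)) \ A)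
    rw [Finset.card_sdiff_of_subset (Finset.filter_subset _ _), Finset.card_range, hAdeg] at h2
    rw [card_neighborFinset_eq_degree] at h1
    omega
  have hdu := G.degree_lt_card_verts u
  refine ⟨G.degree u, by omega, ?_, ?_, u, le_rfl⟩
  · have himg : (A.image q).card = G.degree u := by
      rw [Finset.card_image_of_injOn
        (hBinj.mono (by exact_mod_cast Finset.filter_subset _ _)), hAdeg]
    refine himg.symm.le.trans (Finset.card_le_card fun x hx => ?_)
    obtain ⟨i, hi, rfl⟩ := Finset.mem_image.1 hx
    simp only [hA, Finset.mem_filter, Finset.mem_range] at hi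
    simp only [Finset.mem_filter, Finset.mem_univ, true_and]
    have hne : q i ≠ v := by
      intro h
      have := hinj i (by omega) (Fintype.card V - 1) (by omega) (h.trans hqn.symm)
      omega
    -- As `q i` and v are nonadjacent, maximality of deg u + deg v gives deg (q i) ≤ deg u.
    have := hmax (q i) v hne fun h => hcross i (by omega) hi.2 h.symm
    omega
  -- The n - deg u vertices not adjacent to u, with u among them, have degree at most deg v, again
  -- by maximality, and deg v < n - deg u.
  · rw [← card_neighborFinset_eq_degree, ← Finset.card_compl]
    refine Finset.card_le_card fun x hx => ?_
    simp only [Finset.mem_compl, mem_neighborFinset, Finset.mem_filter, Finset.mem_univ,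
      true_and, Finset.card_compl, card_neighborFinset_eq_degree] at hx ⊢
    by_cases hxu : x = u
    · subst hxu
      omega
    · have := hmax u x (Ne.symm hxu) hx
      omega

/-- The degree condition of **Chvátal's theorem**. -/
theorem exists_degree_condition_of_not_hasHamiltonianCycle {V : Type*} [Fintype V] [DecidableEq V]
    {G : SimpleGraph V} [DecidableRel G.Adj] (h3 : 3 ≤ Fintype.card V)
    (hG : ¬ HasHamiltonianCycle G) :
    ∃ k, 2 * k < Fintype.card V ∧ k ≤ (Finset.univ.filter fun v => G.degree v ≤ k).card ∧
      Fintype.card V - k ≤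
        (Finset.univ.filter fun v => G.degree v < Fintype.card V - k).card ∧
      ∃ u, G.degree u ≤ k := by
  classical
  -- Degrees in a maximal non-Hamiltonian supergraph are at least those in G, so its upper bounds
  -- pass down.
  obtain ⟨H, hGH, hH⟩ := Finite.exists_le_maximal
    (p := fun H : SimpleGraph V => ¬ HasHamiltonianCycle H) hG
  obtain ⟨k, hk, h1, h2, u, hu⟩ := exists_degree_condition_of_maximal h3 hH
  have hd : ∀ v, G.degree v ≤ H.degree v := fun v => degree_le_of_le hGH
  refine ⟨k, hk, h1.trans (Finset.card_le_card ?_), h2.trans (Finset.card_le_card ?_), u,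
    (hd u).trans hu⟩
  · exact Finset.monotone_filter_right _ fun v _ hv => (hd v).trans hv
  · exact Finset.monotone_filter_right _ fun v _ hv => (hd v).trans_lt hv

/-! ### Obstructions to Hamiltonicity -/

lemma not_hasHamiltonianCycle_of_degree_eq_one {V : Type*} [Fintype V] [DecidableEq V]
    {G : SimpleGraph V} [DecidableRel G.Adj] {x : V} (hx : G.degree x = 1) :
    ¬ HasHamiltonianCycle G := by
  rw [hasHamiltonianCycle_iff_exists_isCyclicSeq]
  rintro ⟨h3, q, hq⟩
  have himg : (Finset.range (Fintype.card V)).image q = Finset.univ := by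
    apply Finset.eq_univ_of_card
    rw [Finset.card_image_of_injOn, Finset.card_range]
    intro i hi j hj
    exact hq.1 i (by simpa using hi) j (by simpa using hj)
  have hmem := himg ▸ Finset.mem_univ x
  obtain ⟨i, hi, rfl⟩ := Finset.mem_image.1 hmem
  rw [Finset.mem_range] at hi
  obtain ⟨hinj, hadj, hlast⟩ := hq.rotate hi
  generalize hq' : (fun x => if x + i < Fintype.card V then q (x + i)
    else q (x + i - Fintype.card V)) = q' at hinj hadj hlast
  have h0 : q' 0 = q i := by
    rw [← hq']
    simp [hi]
  rw [← h0] at hx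
  obtain ⟨y, hy⟩ := Finset.card_eq_one.1 hx
  have e1 : q' 1 ∈ G.neighborFinset (q' 0) := by simpa using hadj 0 (by omega)
  have e2 : q' (Fintype.card V - 1) ∈ G.neighborFinset (q' 0) := by simpa using hlast.symm
  rw [hy, Finset.mem_singleton] at e1 e2
  have := hinj _ (by omega) _ (by omega) (e1.trans e2.symm)
  omega

/-- The successor map along a Hamiltonian cycle would inject I into its complement. -/
lemma not_hasHamiltonianCycle_of_isIndepSet {V : Type*} [Fintype V] [DecidableEq V]
    {G : SimpleGraph V} {I : Finset V} (hI : ∀ x ∈ I, ∀ y ∈ I, ¬ G.Adj x y)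
    (hcard : Fintype.card V < 2 * I.card) : ¬ HasHamiltonianCycle G := by
  rw [hasHamiltonianCycle_iff_exists_isCyclicSeq]
  rintro ⟨h3, q, hinj, hadj, hlast⟩
  have himg : (Finset.range (Fintype.card V)).image q = Finset.univ := by
    apply Finset.eq_univ_of_card
    rw [Finset.card_image_of_injOn, Finset.card_range]
    intro i hi j hj
    exact hinj i (by simpa using hi) j (by simpa using hj)
  have hle : I.card ≤ Iᶜ.card := by
    refine Finset.card_le_card_of_forall_subsingleton
      (fun x y => ∃ i < Fintype.card V, q i = x ∧
        y = if i + 1 < Fintype.card V then q (i + 1) else q 0) ?_ ?_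
    · intro x hx
      have hmem := himg ▸ Finset.mem_univ x
      obtain ⟨i, hi, rfl⟩ := Finset.mem_image.1 hmem
      rw [Finset.mem_range] at hi
      refine ⟨_, ?_, i, hi, rfl, rfl⟩
      rw [Finset.mem_compl]
      intro hy
      refine hI _ hx _ hy ?_
      split_ifs with h
      · exact hadj i h
      · rwa [show i = Fintype.card V - 1 by omega]
    · rintro y - x ⟨-, i, hi, rfl, h1⟩ z ⟨-, j, hj, rfl, h2⟩
      rw [h1] at h2
      congr 1
      split_ifs at h2 <;> have := hinj _ (by omega) _ (by omega) h2 <;> omega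
  rw [Finset.card_compl] at hle
  omega

/-! ### Counting edges relative to a vertex set -/

section Counting

variable {V : Type*} (G : SimpleGraph V)

open Classical in
/-- The number of neighbours of `v` in `X`. -/
noncomputable def degIn (X : Finset V) (v : V) : ℕ := (X.filter (G.Adj v)).card

/-- Twice the number of edges of `G` inside `X`. -/
noncomputable def degSum (X : Finset V) : ℕ := ∑ v ∈ X, G.degIn X v

variable {G}

lemma degIn_le_card (X : Finset V) (v : V) : G.degIn X v ≤ X.card := by
  classical exact Finset.card_filter_le _ _

lemma degIn_lt_card {X : Finset V} {v : V} (hv : v ∈ X) : G.degIn X v < X.card := by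
  classical
  refine Finset.card_lt_card (Finset.filter_ssubset.2 ⟨v, hv, G.loopless.irrefl v⟩)

lemma degIn_univ [Fintype V] [DecidableRel G.Adj] (v : V) :
    G.degIn Finset.univ v = G.degree v := by
  rw [← card_neighborFinset_eq_degree, degIn]
  congr 1
  ext
  simp

lemma degIn_add_degIn_sdiff [DecidableEq V] {X Y : Finset V} (h : X ⊆ Y) (v : V) :
    G.degIn X v + G.degIn (Y \ X) v = G.degIn Y v := by
  classical
  unfold degIn
  rw [← Finset.card_union_of_disjoint
    (Finset.disjoint_filter_filter Finset.disjoint_sdiff), ← Finset.filter_union,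
    Finset.union_sdiff_of_subset h]

lemma degIn_add_degIn_compl [Fintype V] [DecidableEq V] [DecidableRel G.Adj] (X : Finset V)
    (v : V) : G.degIn X v + G.degIn Xᶜ v = G.degree v := by
  rw [← degIn_univ, ← degIn_add_degIn_sdiff (Finset.subset_univ X), Finset.compl_eq_univ_sdiff]

lemma not_adj_of_degIn_eq_zero {X : Finset V} {v x : V} (h : G.degIn X v = 0) (hx : x ∈ X) :
    ¬ G.Adj v x := by
  classical
  intro hadj
  have := Finset.card_eq_zero.1 h
  exact Finset.notMem_empty x (this ▸ Finset.mem_filter.2 ⟨hx, hadj⟩)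

lemma adj_of_card_le_degIn {X : Finset V} {v x : V} (h : X.card ≤ G.degIn X v) (hx : x ∈ X) :
    G.Adj v x := by
  classical
  have := Finset.eq_of_subset_of_card_le (Finset.filter_subset (G.Adj v) X) h
  rw [← this] at hx
  exact (Finset.mem_filter.1 hx).2

lemma card_le_degIn {A X : Finset V} {v : V} (hA : A ⊆ X) (h : ∀ x ∈ A, G.Adj v x) :
    A.card ≤ G.degIn X v := by
  classical
  exact Finset.card_le_card fun x hx => Finset.mem_filter.2 ⟨hA hx, h x hx⟩

lemma le_degIn_of_forall_adj {X : Finset V} {v : V} {k : ℕ} (hcard : X.card = k + 1)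
    (hv : v ∈ X) (h : ∀ x ∈ X, x ≠ v → G.Adj v x) : k ≤ G.degIn X v := by
  classical
  have := Finset.card_erase_of_mem hv
  rw [hcard, Nat.add_sub_cancel] at this
  rw [← this]
  refine card_le_degIn (Finset.erase_subset _ _) fun x hx => ?_
  rw [Finset.mem_erase] at hx
  exact h x hx.2 hx.1

lemma degIn_erase_of_not_adj [DecidableEq V] {v w : V} (h : ¬ G.Adj v w) (X : Finset V) :
    G.degIn (X.erase w) v = G.degIn X v := by
  classical
  unfold degIn
  congr 1
  ext y
  simp only [Finset.mem_filter, Finset.mem_erase]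
  refine ⟨fun hy => ⟨hy.1.2, hy.2⟩, fun hy => ⟨⟨?_, hy.1⟩, hy.2⟩⟩
  rintro rfl
  exact h hy.2

lemma sum_degIn_comm (X Y : Finset V) : ∑ x ∈ X, G.degIn Y x = ∑ y ∈ Y, G.degIn X y := by
  classical
  have := Finset.sum_card_bipartiteAbove_eq_sum_card_bipartiteBelow (s := X) (t := Y) G.Adj
  simp only [Finset.bipartiteAbove, Finset.bipartiteBelow] at this
  unfold degIn
  convert! this using 4
  exact G.adj_comm _ _

/-- An edge inside Y \ X is counted at both ends by `degIn Y`; an edge between Y \ X and X is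
counted at its end outside X, once by `degIn Y` and once by `degIn X`. -/
lemma degSum_eq_add_sum_sdiff [DecidableEq V] {X Y : Finset V} (h : X ⊆ Y) :
    G.degSum Y = G.degSum X + ∑ v ∈ Y \ X, (G.degIn Y v + G.degIn X v) := by
  unfold degSum
  rw [← Finset.sum_sdiff h, Finset.sum_add_distrib, sum_degIn_comm (Y \ X) X]
  have : ∑ v ∈ X, G.degIn Y v = ∑ v ∈ X, G.degIn X v + ∑ v ∈ X, G.degIn (Y \ X) v := by
    rw [← Finset.sum_add_distrib]
    exact Finset.sum_congr rfl fun v _ => (degIn_add_degIn_sdiff h v).symm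
  omega

lemma degSum_univ [Fintype V] [DecidableRel G.Adj] :
    G.degSum Finset.univ = 2 * G.edgeFinset.card := by
  rw [← sum_degrees_eq_twice_card_edges, degSum]
  exact Finset.sum_congr rfl fun v _ => degIn_univ v

lemma two_mul_card_edgeFinset_eq [Fintype V] [DecidableEq V] [DecidableRel G.Adj]
    (S : Finset V) :
    2 * G.edgeFinset.card = G.degSum Sᶜ + ∑ v ∈ S, (G.degree v + G.degIn Sᶜ v) := by
  rw [← degSum_univ, degSum_eq_add_sum_sdiff (Finset.subset_univ Sᶜ),
    ← Finset.compl_eq_univ_sdiff, compl_compl]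
  simp_rw [degIn_univ]

lemma degSum_le_of_subset [DecidableEq V] {X Y : Finset V} (h : X ⊆ Y) :
    G.degSum Y ≤ G.degSum X + (Y.card - X.card) * (Y.card - 1 + X.card) := by
  rw [degSum_eq_add_sum_sdiff h, ← Finset.card_sdiff_of_subset h]
  gcongr
  refine Finset.sum_le_card_nsmul _ _ _ fun v hv => ?_
  have h1 := degIn_lt_card (G := G) (Finset.mem_sdiff.1 hv).1
  have h2 := G.degIn_le_card X v
  omega

lemma degSum_eq_two_mul_card_edgeFinset_induce (X : Finset V)
    [DecidableRel (G.induce (X : Set V)).Adj] :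
    G.degSum X = 2 * (G.induce (X : Set V)).edgeFinset.card := by
  classical
  rw [← sum_degrees_eq_twice_card_edges, degSum, ← Finset.sum_coe_sort X]
  refine Finset.sum_congr rfl fun v _ => ?_
  rw [← card_neighborFinset_eq_degree, degIn]
  refine (Finset.card_bij (fun x _ => x.1) ?_ ?_ ?_).symm
  · intro x hx
    rw [mem_neighborFinset] at hx
    exact Finset.mem_filter.2 ⟨x.2, hx⟩
  · intro x _ y _ h
    exact Subtype.ext h
  · intro x hx
    obtain ⟨h1, h2⟩ := Finset.mem_filter.1 hx
    exact ⟨⟨x, h1⟩, by rw [mem_neighborFinset]; exact h2, rfl⟩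

lemma degSum_le_turan {r : ℕ} (hr : 0 < r) {X : Finset V}
    (h : (G.induce (X : Set V)).CliqueFree (r + 1)) :
    G.degSum X ≤ 2 * (turanGraph X.card r).edgeFinset.card := by
  classical
  rw [degSum_eq_two_mul_card_edgeFinset_induce]
  have := (isTuranMaximal_turanGraph (n := X.card) hr).2
  -- Maximality of the Turán graph only compares graphs on the same vertex type `Fin X.card`.
  have e : X ≃ Fin X.card := X.equivFin
  have iso : G.induce (X : Set V) ≃g (G.induce (X : Set V)).map e.toEmbedding := Iso.map e _
  have h2 := this (h.comap iso.symm.isContained)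
  rw [iso.card_edgeFinset_eq]
  gcongr

lemma nonempty_iso_turanGraph_of_degSum_eq {r : ℕ} (hr : 0 < r) {X : Finset V}
    (h : (G.induce (X : Set V)).CliqueFree (r + 1))
    (heq : G.degSum X = 2 * (turanGraph X.card r).edgeFinset.card) :
    Nonempty (G.induce (X : Set V) ≃g turanGraph X.card r) := by
  classical
  have hmax : (G.induce (X : Set V)).IsTuranMaximal r := by
    refine ⟨h, fun H _ hH => ?_⟩
    rw [degSum_eq_two_mul_card_edgeFinset_induce] at heq
    have e : X ≃ Fin X.card := X.equivFin
    have iso : H ≃g H.map e.toEmbedding := Iso.map e _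
    have h2 := (isTuranMaximal_turanGraph (n := X.card) hr).2 (hH.comap iso.symm.isContained)
    have h3 := iso.card_edgeFinset_eq
    have h4 : H.edgeFinset.card ≤ (turanGraph X.card r).edgeFinset.card := by
      rw [h3]
      convert h2
    refine h4.trans ?_
    omega
  have := hmax.nonempty_iso_turanGraph
  rwa [show Fintype.card (X : Set V) = X.card by simp] at this

lemma degSum_eq_of_iso_turanGraph {r m : ℕ} {X : Finset V}
    (h : Nonempty (G.induce (X : Set V) ≃g turanGraph m r)) :
    G.degSum X = 2 * (turanGraph m r).edgeFinset.card := by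
  classical
  rw [degSum_eq_two_mul_card_edgeFinset_induce, h.some.card_edgeFinset_eq]

lemma cliqueFree_induce {n : ℕ} (h : G.CliqueFree n) (X : Set V) :
    (G.induce X).CliqueFree n :=
  h.comap ⟨(Embedding.induce X).toCopy⟩

lemma cliqueFree_induce_of_forall_adj {n : ℕ} (h : G.CliqueFree (n + 1)) {X : Set V} {v : V}
    (hv : ∀ x ∈ X, G.Adj v x) : (G.induce X).CliqueFree n := by
  classical
  intro K hK
  refine h (insert v (K.map (Function.Embedding.subtype _))) ?_
  have hK' : G.IsNClique n (K.map (Function.Embedding.subtype _)) := by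
    have := hK.map (f := Function.Embedding.subtype (· ∈ X))
    exact this.mono (map_comap_le _ _)
  refine hK'.insert fun x hx => ?_
  obtain ⟨y, -, rfl⟩ := Finset.mem_map.1 hx
  exact hv _ y.2

/-- In a `K₄`-free graph, the neighbours of `v` in `Y` span a triangle-free graph, which bounds the
number of edges inside `Y`. -/
lemma two_mul_degSum_le_of_cliqueFree_four {Y : Finset V} {v : V} (h : G.CliqueFree 4) :
    2 * G.degSum Y ≤ G.degIn Y v ^ 2 +
      2 * ((Y.card - G.degIn Y v) * (Y.card - 1 + G.degIn Y v)) := by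
  classical
  have h1 := degSum_le_of_subset (G := G) (Finset.filter_subset (G.Adj v) Y)
  have h2 := degSum_le_turan (r := 2) (by norm_num) (X := Y.filter (G.Adj v))
    (cliqueFree_induce_of_forall_adj h (v := v) fun x hx => by simpa using (by simpa using hx :
      x ∈ Y ∧ G.Adj v x).2)
  have h3 := mul_card_edgeFinset_turanGraph_le (n := (Y.filter (G.Adj v)).card) (r := 2)
  have h4 : (Y.filter (G.Adj v)).card = G.degIn Y v := rfl
  rw [h4] at h1 h2 h3
  omega

lemma two_mul_card_edgeFinset_le [Fintype V] [DecidableEq V] [DecidableRel G.Adj]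
    {S : Finset V} {a k : ℕ} (hdeg : ∀ v ∈ S, G.degree v ≤ k)
    (ha : ∀ v ∈ S, G.degIn Sᶜ v ≤ a) :
    2 * G.edgeFinset.card ≤ G.degSum Sᶜ + S.card * (k + a) := by
  rw [two_mul_card_edgeFinset_eq S]
  gcongr
  exact Finset.sum_le_card_nsmul _ _ _ fun v hv => add_le_add (hdeg v hv) (ha v hv)

lemma degIn_compl_le [Fintype V] [DecidableEq V] [DecidableRel G.Adj] (S : Finset V) (v : V) :
    G.degIn Sᶜ v ≤ G.degree v := by
  have := G.degIn_add_degIn_compl S v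
  omega

end Counting

/-! ### Turán numbers and their growth -/

section TuranNumber

/-- A vertex added to the Turán graph is joined to all but one of the parts. -/
lemma card_edgeFinset_turanGraph_succ {r : ℕ} (hr : 0 < r) (n : ℕ) :
    (turanGraph (n + 1) r).edgeFinset.card =
      (turanGraph n r).edgeFinset.card + (n - n / r) := by
  induction n using Nat.strong_induction_on with
  | _ n ih =>
    rcases lt_or_ge n r with h | h
    · have htop : ∀ m ≤ r, (turanGraph m r).edgeFinset.card = m.choose 2 := by
        intro m hm
        have := card_edgeFinset_top_eq_card_choose_two (V := Fin m)
        rw [Fintype.card_fin] at this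
        rw [← this]
        congr!
        exact turanGraph_eq_top.2 (Or.inr hm)
      rw [htop _ h, htop _ h.le, Nat.div_eq_of_lt h, Nat.choose_succ_succ' n 1]
      simp
      omega
    · obtain ⟨m, rfl⟩ := Nat.exists_eq_add_of_le' h
      rw [show m + r + 1 = m + 1 + r by ring, card_edgeFinset_turanGraph_add,
        card_edgeFinset_turanGraph_add, ih m (by omega), Nat.add_div_right _ hr]
      have := Nat.div_le_self m r
      have e : (m + 1) * (r - 1) = m * (r - 1) + (r - 1) := by ring
      rw [e]
      omega

lemma card_edgeFinset_turanGraph_zero (r : ℕ) : (turanGraph 0 r).edgeFinset.card = 0 := by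
  simp [card_edgeFinset_turanGraph]

/-- The growth of the number of edges of Turán graphs, with the number of vertices. -/
lemma mul_card_edgeFinset_turanGraph_add_le {r s : ℕ} (hs : 0 < s) (hr : s ≤ r) (m l : ℕ) :
    2 * s * (turanGraph m r).edgeFinset.card + (s - 1) * (l * (2 * m + l - 1)) ≤
      2 * s * (turanGraph (m + l) r).edgeFinset.card := by
  induction l with
  | zero => simp
  | succ l ih =>
    rw [show (turanGraph (m + (l + 1)) r).edgeFinset.card = _ from
      card_edgeFinset_turanGraph_succ (hs.trans_le hr) (m + l)]
    have h1 : (m + l) / r ≤ (m + l) / s := Nat.div_le_div_left hr hs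
    have h2 : s * ((m + l) / s) ≤ m + l := Nat.mul_div_le _ _
    have h3 : (m + l) / s ≤ m + l := Nat.div_le_self _ _
    -- The new vertex has degree at least (1 - 1/s)(m + l).
    have h4 : (s - 1) * (m + l) ≤ s * (m + l - (m + l) / r) := by
      zify [hs, h1.trans h3, Nat.one_le_iff_ne_zero.2 hs.ne']
      zify at h1 h2
      nlinarith
    have h5 : (l + 1) * (2 * m + (l + 1) - 1) = l * (2 * m + l - 1) + 2 * (m + l) := by
      rcases Nat.eq_zero_or_pos (m + l) with h0 | h0
      · obtain ⟨rfl, rfl⟩ : m = 0 ∧ l = 0 := by omega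
        rfl
      · obtain ⟨c, hc⟩ := Nat.exists_eq_add_of_le' (show 1 ≤ 2 * m + l by omega)
        have : 2 * m + (l + 1) - 1 = c + 1 := by omega
        rw [this, hc, Nat.add_sub_cancel]
        have : l = c + 1 - 2 * m := by omega
        nlinarith
    rw [h5]
    nlinarith

/-- Rounding in T_3(n) loses at most 1/3 against n²/3. -/
lemma sq_le_three_mul_card_edgeFinset_turanGraph (n : ℕ) :
    n ^ 2 ≤ 3 * (turanGraph n 3).edgeFinset.card + 1 := by
  have key : ∀ m, (3 * m) ^ 2 ≤ 3 * (turanGraph (3 * m) 3).edgeFinset.card := by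
    intro m
    induction m with
    | zero => simp
    | succ m ih =>
      rw [mul_add, mul_one, card_edgeFinset_turanGraph_add]
      simp [Nat.choose]
      nlinarith
  have hm := key (n / 3)
  have := Nat.div_add_mod n 3
  have hlt := Nat.mod_lt n (show 3 > 0 by norm_num)
  generalize n / 3 = m at *
  generalize n % 3 = c at *
  subst this
  interval_cases c
  · simpa using hm.trans (Nat.le_succ _)
  · rw [card_edgeFinset_turanGraph_succ (by norm_num), Nat.mul_div_cancel_left _ (by norm_num)]
    have : 3 * m - m = 2 * m := by omega
    rw [this]
    nlinarith
  · rw [show 3 * m + 2 = 3 * m + 1 + 1 by ring, card_edgeFinset_turanGraph_succ (by norm_num),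
      card_edgeFinset_turanGraph_succ (by norm_num), Nat.mul_div_cancel_left _ (by norm_num)]
    have : 3 * m - m = 2 * m := by omega
    have : 3 * m + 1 - (3 * m + 1) / 3 = 2 * m + 1 := by omega
    simp only [*]
    nlinarith

/-- The growth bound with s = 5 and l = k - 1 has the factor k - 1 in common with k² - 1; cancelling
it leaves 3k + 9 < 4m. Otherwise m = k + 1 and k ≤ 5, a finite check. -/
lemma sq_add_card_edgeFinset_turanGraph_le_of_five_le {r : ℕ} (hr : 5 ≤ r) {k m : ℕ}
    (hk : 2 ≤ k) (hm : k + 1 ≤ m) :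
    k ^ 2 + (turanGraph m r).edgeFinset.card < (turanGraph (m + (k - 1)) r).edgeFinset.card + 1 ∨
    k ^ 2 + (turanGraph m r).edgeFinset.card =
      (turanGraph (m + (k - 1)) r).edgeFinset.card + 1 ∧
      m = k + 1 ∧ (k = 2 ∨ r = 5 ∧ (k = 3 ∨ k = 4)) := by
  have hsucc := fun n => card_edgeFinset_turanGraph_succ (show 0 < r by omega) n
  by_cases h : 3 * k + 9 < 4 * m
  · left
    have := mul_card_edgeFinset_turanGraph_add_le (show 0 < 5 by norm_num) hr m (k - 1)
    obtain ⟨l, rfl⟩ := Nat.exists_eq_add_of_le' (show 1 ≤ k by omega)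
    simp only [Nat.add_sub_cancel] at this ⊢
    obtain ⟨c, hc⟩ := Nat.exists_eq_add_of_le' (show 1 ≤ 2 * m + l by omega)
    rw [hc, Nat.add_sub_cancel] at this
    nlinarith
  · have hk5 : k ≤ 5 := by omega
    obtain rfl : m = k + 1 := by omega
    have d3 : 3 / r = 0 := Nat.div_eq_of_lt (by omega)
    have d4 : 4 / r = 0 := Nat.div_eq_of_lt (by omega)
    have hd : ∀ i < 10, i / r ≤ 1 := fun i hi => by
      rw [← Nat.lt_succ_iff, Nat.div_lt_iff_lt_mul (by omega)]
      omega
    have d5 : r = 5 ∨ 5 / r = 0 := by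
      rcases hr.eq_or_lt with h | h
      · exact Or.inl h.symm
      · exact Or.inr (Nat.div_eq_of_lt h)
    have e6 := hd 6 (by norm_num)
    have e7 := hd 7 (by norm_num)
    have e8 := hd 8 (by norm_num)
    have e9 := hd 9 (by norm_num)
    have s3 := hsucc 3
    have s4 := hsucc 4
    have s5 := hsucc 5
    have s6 := hsucc 6
    have s7 := hsucc 7
    have s8 := hsucc 8
    have s9 := hsucc 9
    rw [d3] at s3
    rw [d4] at s4
    clear hsucc hd d3 d4
    generalize ht : (fun n => (turanGraph n r).edgeFinset.card) = t
    replace ht : ∀ n, (turanGraph n r).edgeFinset.card = t n := congrFun ht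
    simp only [ht] at *
    clear ht
    rcases d5 with rfl | d5
    · interval_cases k <;> norm_num at * <;> omega
    · rw [d5] at s5
      clear d5
      interval_cases k <;> norm_num at * <;> omega

/-- The same cancellation with s = 4 leaves 5k + 14 < 6m. Otherwise m = k + 1 and 5 ≤ k ≤ 8, the
lower end coming from 11 ≤ m + k. -/
lemma sq_add_card_edgeFinset_turanGraph_le_of_eq_four {k m : ℕ}
    (hk : 2 ≤ k) (hm : k + 1 ≤ m) (hn : 11 ≤ m + k) :
    k ^ 2 + (turanGraph m 4).edgeFinset.card < (turanGraph (m + (k - 1)) 4).edgeFinset.card + 1 ∨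
    k ^ 2 + (turanGraph m 4).edgeFinset.card =
      (turanGraph (m + (k - 1)) 4).edgeFinset.card + 1 ∧ m = 6 ∧ k = 5 := by
  by_cases h : 5 * k + 14 < 6 * m
  · left
    have := mul_card_edgeFinset_turanGraph_add_le (show 0 < 4 by norm_num) le_rfl m (k - 1)
    obtain ⟨l, rfl⟩ := Nat.exists_eq_add_of_le' (show 1 ≤ k by omega)
    simp only [Nat.add_sub_cancel] at this ⊢
    obtain ⟨c, hc⟩ := Nat.exists_eq_add_of_le' (show 1 ≤ 2 * m + l by omega)
    rw [hc, Nat.add_sub_cancel] at this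
    nlinarith
  · have hk5 : k ≤ 8 := by omega
    have hk8 : 5 ≤ k := by omega
    obtain rfl : m = k + 1 := by omega
    interval_cases k <;> simp [card_edgeFinset_turanGraph, Nat.choose]

/-- With s = 3 the cancellation leaves 4k + 10 < 4m, that is, m ≥ k + 3. -/
lemma sq_add_card_edgeFinset_turanGraph_lt_of_eq_three {k m : ℕ}
    (hk : 2 ≤ k) (hm : k + 3 ≤ m) :
    k ^ 2 + (turanGraph m 3).edgeFinset.card <
      (turanGraph (m + (k - 1)) 3).edgeFinset.card + 1 := by
  have := mul_card_edgeFinset_turanGraph_add_le (show 0 < 3 by norm_num) le_rfl m (k - 1)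
  obtain ⟨l, rfl⟩ := Nat.exists_eq_add_of_le' (show 1 ≤ k by omega)
  simp only [Nat.add_sub_cancel] at this ⊢
  obtain ⟨c, hc⟩ := Nat.exists_eq_add_of_le' (show 1 ≤ 2 * m + l by omega)
  rw [hc, Nat.add_sub_cancel] at this
  nlinarith

end TuranNumber

/-! ### Recognising complete multipartite graphs -/

section Multipartite

lemma cliqueFree_of_iso_multipartite {V : Type*} {G : SimpleGraph V} {m n : ℕ} {s : Fin m → ℕ} (e : G ≃g multipartite s)
    (h : m < n) : G.CliqueFree n :=
  (cliqueFree_completeMultipartiteGraph (fun i => Fin (s i)) (by simpa using h)).comap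
    e.isContained

variable {V : Type*} [Fintype V] {G : SimpleGraph V}

lemma nonempty_iso_multipartite {m : ℕ} {s : Fin m → ℕ} (c : V → Fin m)
    (hadj : ∀ x y, G.Adj x y ↔ c x ≠ c y)
    (hs : ∀ i, (Finset.univ.filter fun v => c v = i).card = s i) :
    Nonempty (G ≃g multipartite s) := by
  classical
  have hcard : ∀ i, Fintype.card {v // c v = i} = s i := fun i => by
    rw [Fintype.card_subtype, hs]
  refine ⟨⟨(Equiv.sigmaFiberEquiv c).symm.trans
    (Equiv.sigmaCongrRight fun i => Fintype.equivFinOfCardEq (hcard i)), fun {x y} => ?_⟩⟩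
  rw [hadj]
  simp [multipartite, Equiv.sigmaFiberEquiv]

lemma exists_coloring_of_iso_multipartite {m : ℕ} {s : Fin m → ℕ} (e : G ≃g multipartite s) :
    ∃ c : V → Fin m, (∀ x y, G.Adj x y ↔ c x ≠ c y) ∧
      ∀ i, (Finset.univ.filter fun v => c v = i).card = s i := by
  classical
  refine ⟨fun v => (e v).1, fun x y => ?_, fun i => ?_⟩
  · rw [← e.map_adj_iff]
    simp [multipartite]
  · rw [← Fintype.card_subtype, ← Fintype.card_fin (s i)]
    refine Fintype.card_congr ((e.toEquiv.subtypeEquiv (q := fun x => x.1 = i) fun _ => ?_).trans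
      (Equiv.sigmaSubtype i))
    rfl

lemma card_eq_of_iso_multipartite {m : ℕ} {s : Fin m → ℕ} (e : G ≃g multipartite s) :
    Fintype.card V = ∑ i, s i := by
  rw [Fintype.card_congr e.toEquiv, Fintype.card_sigma]
  simp

lemma two_mul_card_edgeFinset_of_iso_multipartite [DecidableRel G.Adj] {m : ℕ} {s : Fin m → ℕ}
    (e : G ≃g multipartite s) :
    2 * G.edgeFinset.card = ∑ i, s i * (Fintype.card V - s i) := by
  classical
  obtain ⟨c, hadj, hs⟩ := exists_coloring_of_iso_multipartite e
  have hdeg : ∀ v, G.degree v = Fintype.card V - s (c v) := by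
    intro v
    rw [← hs, ← Finset.card_compl, ← card_neighborFinset_eq_degree]
    congr 1
    ext x
    simp [hadj, eq_comm]
  rw [← sum_degrees_eq_twice_card_edges, ← Finset.sum_fiberwise Finset.univ c]
  refine Finset.sum_congr rfl fun i _ => ?_
  rw [← hs, ← smul_eq_mul, ← Finset.sum_const]
  refine Finset.sum_congr rfl fun v hv => ?_
  rw [hdeg, hs, (Finset.mem_filter.1 hv).2]

lemma not_hasHamiltonianCycle_of_iso_multipartite [DecidableEq V] {m : ℕ} {s : Fin m → ℕ}
    (e : G ≃g multipartite s) (i : Fin m) (h : Fintype.card V < 2 * s i) :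
    ¬ HasHamiltonianCycle G := by
  obtain ⟨c, hadj, hs⟩ := exists_coloring_of_iso_multipartite e
  refine not_hasHamiltonianCycle_of_isIndepSet (I := Finset.univ.filter fun v => c v = i) ?_
    (by rwa [hs])
  intro x hx y hy hxy
  rw [hadj, (Finset.mem_filter.1 hx).2, (Finset.mem_filter.1 hy).2] at hxy
  exact hxy rfl

/-- A graph which is the join of an independent set and a complete multipartite graph. -/
lemma nonempty_iso_multipartite_cons [DecidableEq V] {m : ℕ} {s : Fin m → ℕ} {I : Finset V}
    (hI : ∀ x ∈ I, ∀ y ∈ I, ¬ G.Adj x y) (hjoin : ∀ x ∈ I, ∀ y ∉ I, G.Adj x y) (c : V → Fin m)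
    (hadj : ∀ x ∉ I, ∀ y ∉ I, (G.Adj x y ↔ c x ≠ c y))
    (hs : ∀ i, (Iᶜ.filter fun v => c v = i).card = s i) :
    Nonempty (G ≃g multipartite (Fin.cons I.card s : Fin (m + 1) → ℕ)) := by
  refine nonempty_iso_multipartite (fun v => if v ∈ I then 0 else (c v).succ) ?_ ?_
  · intro x y
    by_cases hx : x ∈ I <;> by_cases hy : y ∈ I <;> simp only [hx, hy, if_true, if_false]
    · simpa using hI x hx y hy
    · simpa [(Fin.succ_ne_zero _).symm] using hjoin x hx y hy
    · simpa using (hjoin y hy x hx).symm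
    · simpa using hadj x hx y hy
  · intro i
    cases i using Fin.cases with
    | zero =>
      rw [Fin.cons_zero]
      congr 1
      ext v
      by_cases hv : v ∈ I <;> simp [hv]
    | succ i =>
      rw [Fin.cons_succ, ← hs]
      congr 1
      ext v
      by_cases hv : v ∈ I <;> simp [hv, (Fin.succ_ne_zero i).symm]

/-- A graph which is the join of an independent set and a complete graph. -/
lemma nonempty_iso_multipartite_cons_one [DecidableEq V] {k : ℕ} {I : Finset V}
    (hk : Iᶜ.card = k) (hI : ∀ x ∈ I, ∀ y ∈ I, ¬ G.Adj x y)
    (hjoin : ∀ x ∈ I, ∀ y ∉ I, G.Adj x y)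
    (hadj : ∀ x ∉ I, ∀ y ∉ I, x ≠ y → G.Adj x y) :
    Nonempty (G ≃g multipartite (Fin.cons I.card fun _ : Fin k => 1)) := by
  -- For k = 0, `Fin k` has no default label for the vertices of I.
  rcases Nat.eq_zero_or_pos k with rfl | hpos
  · have hall : ∀ v, v ∈ I := by simpa [Finset.eq_empty_iff_forall_notMem] using hk
    refine nonempty_iso_multipartite (fun _ => 0) ?_ ?_
    · intro x y
      simpa using hI x (hall x) y (hall y)
    · intro i
      rw [show i = 0 from Fin.ext (by omega)]
      simp [Finset.eq_univ_iff_forall.2 hall]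
  have e : {v // v ∈ Iᶜ} ≃ Fin k := Fintype.equivFinOfCardEq (by rw [Fintype.card_coe, hk])
  refine nonempty_iso_multipartite_cons hI hjoin
    (fun v => if h : v ∈ Iᶜ then e ⟨v, h⟩ else ⟨0, hpos⟩) ?_ ?_
  · intro x hx y hy
    rw [dif_pos (Finset.mem_compl.2 hx), dif_pos (Finset.mem_compl.2 hy), e.injective.ne_iff,
      Ne, Subtype.mk.injEq]
    exact ⟨fun h => h.ne, hadj x hx y hy⟩
  · intro i
    rw [Finset.card_eq_one]
    refine ⟨(e.symm i).1, ?_⟩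
    ext v
    rw [Finset.mem_filter, Finset.mem_singleton]
    constructor
    · rintro ⟨hv, h⟩
      rw [dif_pos hv] at h
      rw [← h, e.symm_apply_apply]
    · rintro rfl
      refine ⟨(e.symm i).2, ?_⟩
      rw [dif_pos (e.symm i).2]
      simp

end Multipartite

/-! ### Structure in the equality case -/

section Equality

variable {V : Type*} [Fintype V] [DecidableEq V] {G : SimpleGraph V} [DecidableRel G.Adj]

/-- The vertices of `S` are independent and joined to all vertices outside `S` except `w`. -/
lemma indep_and_join_of_degIn_eq {S : Finset V} {k : ℕ} {w : V} (hw : w ∉ S)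
    (hcard : Sᶜ.card = k + 1) (hdeg : ∀ v ∈ S, G.degree v = k)
    (hdegIn : ∀ v ∈ S, G.degIn Sᶜ v = k) (hwdeg : G.degree w ≤ k) (hwdegIn : k ≤ G.degIn Sᶜ w) :
    (∀ x ∈ insert w S, ∀ y ∈ insert w S, ¬ G.Adj x y) ∧
      ∀ x ∈ insert w S, ∀ y ∉ insert w S, G.Adj x y := by
  have hw0 : G.degIn S w = 0 := by
    have := G.degIn_add_degIn_compl S w
    omega
  have h0 : ∀ v ∈ S, G.degIn S v = 0 := fun v hv => by
    have := G.degIn_add_degIn_compl S v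
    rw [hdeg v hv, hdegIn v hv] at this
    omega
  have hwS : ∀ x ∈ S, ¬ G.Adj w x := fun x hx => not_adj_of_degIn_eq_zero hw0 hx
  have herase : (Sᶜ.erase w).card = k := by
    rw [Finset.card_erase_of_mem (Finset.mem_compl.2 hw), hcard, Nat.add_sub_cancel]
  constructor
  · intro x hx y hy
    rcases Finset.mem_insert.1 hx with hx | hx <;> rcases Finset.mem_insert.1 hy with hy | hy
    · rw [hx, hy]
      exact G.loopless.irrefl _
    · rw [hx]
      exact hwS y hy
    · rw [hy]
      exact fun h => hwS x hx h.symm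
    · exact not_adj_of_degIn_eq_zero (h0 x hx) hy
  · intro x hx y hy
    have hy' : y ∈ Sᶜ.erase w := by
      rw [Finset.mem_insert, not_or] at hy
      exact Finset.mem_erase.2 ⟨hy.1, Finset.mem_compl.2 hy.2⟩
    refine adj_of_card_le_degIn ?_ hy'
    rw [herase]
    rcases Finset.mem_insert.1 hx with rfl | hx
    · rwa [degIn_erase_of_not_adj (G.loopless.irrefl _)]
    · rw [degIn_erase_of_not_adj fun h => hwS x hx h.symm, hdegIn x hx]

/-- Equality in the edge count forces `S` to be independent, with all degrees maximal. -/
lemma degrees_eq_of_card_edgeFinset_eq {r k : ℕ} (hr : 0 < r) (hG : G.CliqueFree (r + 1))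
    {S : Finset V} (hS : S.card = k) (hdeg : ∀ v ∈ S, G.degree v ≤ k)
    (heq : k ^ 2 + (turanGraph Sᶜ.card r).edgeFinset.card ≤ G.edgeFinset.card) :
    (∀ v ∈ S, G.degree v = k) ∧ (∀ v ∈ S, G.degIn Sᶜ v = k) ∧
      Nonempty (G.induce (Sᶜ : Finset V) ≃g turanGraph Sᶜ.card r) := by
  have hT := degSum_le_turan hr (cliqueFree_induce hG (Sᶜ : Finset V))
  have h2 := two_mul_card_edgeFinset_eq (G := G) S
  have hle : ∀ v ∈ S, G.degree v + G.degIn Sᶜ v ≤ 2 * k := fun v hv => by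
    have := degIn_compl_le (G := G) S v
    have := hdeg v hv
    omega
  have hsum : ∑ v ∈ S, (G.degree v + G.degIn Sᶜ v) ≤ ∑ _v ∈ S, 2 * k := Finset.sum_le_sum hle
  have hconst : ∑ _v ∈ S, 2 * k = 2 * k ^ 2 := by
    rw [Finset.sum_const, hS, smul_eq_mul]
    ring
  have hall := (Finset.sum_eq_sum_iff_of_le hle).1 (by omega)
  have hboth : ∀ v ∈ S, G.degree v = k ∧ G.degIn Sᶜ v = k := fun v hv => by
    have := degIn_compl_le (G := G) S v
    have := hdeg v hv
    have := hall v hv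
    omega
  exact ⟨fun v hv => (hboth v hv).1, fun v hv => (hboth v hv).2,
    nonempty_iso_turanGraph_of_degSum_eq hr (cliqueFree_induce hG _) (by omega)⟩

/-- Here T_r(k+1) is complete, so w already has k neighbours outside S and none are left for it in
S. -/
lemma nonempty_iso_multipartite_of_iso_turanGraph_of_le {r k : ℕ} (hkr : k + 1 ≤ r)
    {S : Finset V} {w : V} (hw : w ∉ S) (hS : S.card = k)
    (hcard : Sᶜ.card = k + 1) (hdeg : ∀ v ∈ S, G.degree v = k)
    (hdegIn : ∀ v ∈ S, G.degIn Sᶜ v = k) (hwdeg : G.degree w ≤ k)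
    (φ : G.induce (Sᶜ : Finset V) ≃g turanGraph (k + 1) r) :
    Nonempty (G ≃g multipartite (Fin.cons (k + 1) fun _ : Fin k => 1)) := by
  have htop : ∀ i j, (turanGraph (k + 1) r).Adj i j ↔ i ≠ j := by
    rw [turanGraph_eq_top.2 (Or.inr hkr)]
    simp
  have hclique : ∀ x ∈ Sᶜ, ∀ y ∈ Sᶜ, x ≠ y → G.Adj x y := by
    intro x hx y hy hxy
    have h := φ.map_adj_iff (v := ⟨x, by exact_mod_cast hx⟩) (w := ⟨y, by exact_mod_cast hy⟩)
    rw [htop, φ.injective.ne_iff] at h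
    exact h.1 fun h => hxy (congrArg Subtype.val h)
  have hw' : w ∈ Sᶜ := Finset.mem_compl.2 hw
  obtain ⟨hI, hjoin⟩ := indep_and_join_of_degIn_eq hw hcard hdeg hdegIn hwdeg
    (le_degIn_of_forall_adj hcard hw' fun x hx hxw => hclique w hw' x hx hxw.symm)
  have hIcard : (insert w S).card = k + 1 := by
    rw [Finset.card_insert_of_notMem hw, hS]
  have key := nonempty_iso_multipartite_cons_one (k := k) ?_ hI hjoin fun x hx y hy hxy => ?_
  · rwa [hIcard] at key
  · rw [Finset.compl_insert, Finset.card_erase_of_mem hw', hcard, Nat.add_sub_cancel]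
  · rw [Finset.mem_insert, not_or] at hx hy
    exact hclique x (Finset.mem_compl.2 hx.2) y (Finset.mem_compl.2 hy.2) hxy

/-- T_4(6) has parts of sizes 2, 2, 1, 1. If w lay in a part of size two, a vertex of S missing w
would see a K_4 avoiding w, giving a K_5; so w would see all five vertices of S and one more, too
many. Hence w is a singleton part, with five neighbours outside S and none in S. -/
lemma nonempty_iso_multipartite_of_iso_turanGraph_six_four (hG : G.CliqueFree 5)
    {S : Finset V} {w : V} (hw : w ∉ S) (hS : S.card = 5)
    (hcard : Sᶜ.card = 6) (hdeg : ∀ v ∈ S, G.degree v = 5)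
    (hdegIn : ∀ v ∈ S, G.degIn Sᶜ v = 5) (hwdeg : G.degree w ≤ 5)
    (φ : G.induce (Sᶜ : Finset V) ≃g turanGraph 6 4) :
    Nonempty (G ≃g multipartite ![6, 2, 2, 1]) := by
  classical
  have hw' : w ∈ Sᶜ := Finset.mem_compl.2 hw
  set φ' : V → Fin 6 := fun v => if h : v ∈ Sᶜ then φ ⟨v, by exact_mod_cast h⟩ else 0 with hφ'
  set ψ : Fin 6 → V := fun i => (φ.symm i).1 with hψ
  have hψmem : ∀ i, ψ i ∈ Sᶜ := fun i => by exact_mod_cast (φ.symm i).2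
  have hφψ : ∀ i, φ' (ψ i) = i := fun i => by
    simp only [hφ', dif_pos (hψmem i)]
    exact φ.apply_symm_apply i
  have hψφ : ∀ v ∈ Sᶜ, ψ (φ' v) = v := fun v hv => by
    simp only [hφ', dif_pos hv, hψ, φ.symm_apply_apply]
  have hadj : ∀ x ∈ Sᶜ, ∀ y ∈ Sᶜ, (G.Adj x y ↔ (φ' x : ℕ) % 4 ≠ (φ' y : ℕ) % 4) := by
    intro x hx y hy
    have h := φ.map_adj_iff (v := ⟨x, by exact_mod_cast hx⟩) (w := ⟨y, by exact_mod_cast hy⟩)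
    simp only [hφ', dif_pos hx, dif_pos hy]
    exact h.symm
  have hψadj : ∀ i j, G.Adj (ψ i) (ψ j) ↔ (i : ℕ) % 4 ≠ (j : ℕ) % 4 := by
    intro i j
    rw [hadj _ (hψmem i) _ (hψmem j), hφψ, hφψ]
  -- `w` is a vertex of a part of size one
  have hw23 : φ' w = 2 ∨ φ' w = 3 := by
    by_contra hne
    -- Parts are the residue classes {0,4}, {1,5}, {2}, {3}; Q picks one vertex from each while
    -- avoiding j.
    have hQ : ∀ j : Fin 6, ¬ (j = 2 ∨ j = 3) → ∃ Q : Finset (Fin 6), Q.card = 4 ∧ j ∉ Q ∧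
        (∀ x ∈ Q, ∀ y ∈ Q, x ≠ y → (x : ℕ) % 4 ≠ (y : ℕ) % 4) ∧ (j : ℕ) % 4 ≠ 2 := by
      intro j hj
      by_cases hj4 : j = 0
      · exact ⟨{1, 2, 3, 4}, by subst hj4; decide⟩
      · by_cases hj1 : j = 1
        · exact ⟨{0, 2, 3, 5}, by subst hj1; decide⟩
        · exact ⟨{0, 1, 2, 3}, by revert hj hj4 hj1; revert j; decide⟩
    obtain ⟨Q, hQcard, hjQ, hQ, hj2⟩ := hQ _ hne
    have hwS : ∀ s ∈ S, G.Adj s w := by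
      intro s hs
      by_contra hsw
      have hall : ∀ x ∈ Sᶜ.erase w, G.Adj s x := by
        intro x hx
        refine adj_of_card_le_degIn ?_ hx
        rw [Finset.card_erase_of_mem hw', hcard, degIn_erase_of_not_adj hsw, hdegIn s hs]
      have hinj : Set.InjOn ψ (Q : Set (Fin 6)) := fun i _ j _ hij => by
        rw [← hφψ i, hij, hφψ]
      have hclique : G.IsNClique 4 (Q.image ψ) := by
        refine ⟨?_, by rw [Finset.card_image_of_injOn hinj, hQcard]⟩
        intro x hx y hy hxy
        obtain ⟨i, hi, rfl⟩ := Finset.mem_image.1 (Finset.mem_coe.1 hx)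
        obtain ⟨j, hj, rfl⟩ := Finset.mem_image.1 (Finset.mem_coe.1 hy)
        exact (hψadj i j).2 (hQ i hi j hj fun h => hxy (by rw [h]))
      refine hG _ (hclique.insert (a := s) fun x hx => ?_)
      obtain ⟨i, hi, rfl⟩ := Finset.mem_image.1 hx
      refine hall _ (Finset.mem_erase.2 ⟨?_, hψmem i⟩)
      intro h
      rw [← h, hφψ] at hjQ
      exact hjQ hi
    have h1 : 5 ≤ G.degIn S w := by
      rw [← hS]
      exact card_le_degIn subset_rfl fun x hx => (hwS x hx).symm
    have h2 : 0 < G.degIn Sᶜ w := by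
      refine Nat.pos_of_ne_zero fun h => not_adj_of_degIn_eq_zero h (hψmem 2) ?_
      rw [hadj w hw' _ (hψmem 2), hφψ]
      exact hj2
    have := G.degIn_add_degIn_compl S w
    omega
  have hmod : ∀ i j : Fin 6, (i = 2 ∨ i = 3) → j ≠ i → (i : ℕ) % 4 ≠ (j : ℕ) % 4 := by decide
  have hφinj : ∀ x ∈ Sᶜ, ∀ y ∈ Sᶜ, φ' x = φ' y → x = y := fun x hx y hy h => by
    rw [← hψφ x hx, h, hψφ y hy]
  obtain ⟨hI, hjoin⟩ := indep_and_join_of_degIn_eq hw hcard hdeg hdegIn hwdeg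
    (le_degIn_of_forall_adj hcard hw' fun x hx hxw => (hadj w hw' x hx).2
      (hmod _ _ hw23 fun h => hxw (hφinj x hx w hw' h)))
  have hIcard : (insert w S).card = 6 := by
    rw [Finset.card_insert_of_notMem hw, hS]
  -- Whichever of 2 and 3 is w, the other remains as the singleton part, so both can carry the label
  -- 2.
  let f : Fin 6 → Fin 3 := ![0, 1, 2, 2, 0, 1]
  have hf : ∀ a i j : Fin 6, (a = 2 ∨ a = 3) → i ≠ a → j ≠ a →
      ((i : ℕ) % 4 ≠ (j : ℕ) % 4 ↔ f i ≠ f j) := by decide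
  have hfcard : ∀ a : Fin 6, (a = 2 ∨ a = 3) → ∀ i : Fin 3,
      (Finset.univ.filter fun j => j ≠ a ∧ f j = i).card = (![2, 2, 1] : Fin 3 → ℕ) i := by
    decide
  have hcons : (![6, 2, 2, 1] : Fin 4 → ℕ) = Fin.cons (insert w S).card ![2, 2, 1] := by
    rw [hIcard]
    rfl
  rw [hcons]
  have hnot : ∀ x, x ∉ insert w S ↔ x ∈ Sᶜ ∧ x ≠ w := fun x => by
    rw [Finset.mem_insert, not_or, Finset.mem_compl, and_comm]
  refine nonempty_iso_multipartite_cons hI hjoin (fun v => f (φ' v)) ?_ ?_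
  · intro x hx y hy
    rw [hnot] at hx hy
    rw [hadj x hx.1 y hy.1]
    exact hf _ _ _ hw23 (fun h => hx.2 (hφinj _ hx.1 _ hw' h))
      (fun h => hy.2 (hφinj _ hy.1 _ hw' h))
  · intro i
    rw [← hfcard _ hw23 i]
    refine Finset.card_bij (fun v _ => φ' v) ?_ ?_ ?_
    · intro v hv
      rw [Finset.mem_filter, Finset.mem_compl, hnot] at hv
      exact Finset.mem_filter.2
        ⟨Finset.mem_univ _, fun h => hv.1.2 (hφinj _ hv.1.1 _ hw' h), hv.2⟩
    · intro x hx y hy h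
      rw [Finset.mem_filter, Finset.mem_compl, hnot] at hx hy
      exact hφinj x hx.1.1 y hy.1.1 h
    · intro j hj
      rw [Finset.mem_filter] at hj
      refine ⟨ψ j, ?_, hφψ j⟩
      rw [Finset.mem_filter, Finset.mem_compl, hnot, hφψ]
      refine ⟨⟨hψmem j, ?_⟩, hj.2.2⟩
      rintro h
      exact hj.2.1 (by rw [← hφψ j, h])

end Equality

/-! ### The upper bound and its extremal graphs -/

section Bound

variable {V : Type*} [Fintype V] [DecidableEq V] {G : SimpleGraph V} [DecidableRel G.Adj]

lemma card_edgeFinset_le_sq_add {r k : ℕ} (hr : 0 < r) (hG : G.CliqueFree (r + 1))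
    {S : Finset V} (hS : S.card = k) (hdeg : ∀ v ∈ S, G.degree v ≤ k) :
    G.edgeFinset.card ≤ k ^ 2 + (turanGraph Sᶜ.card r).edgeFinset.card := by
  have h1 := two_mul_card_edgeFinset_le hdeg fun v hv => (degIn_compl_le S v).trans (hdeg v hv)
  have h2 := degSum_le_turan hr (cliqueFree_induce hG (Sᶜ : Finset V))
  rw [hS] at h1
  nlinarith

/-- For `K₄`-free graphs, the neighbourhoods of the vertices of `S` are triangle-free, which
improves on `card_edgeFinset_le_sq_add` when few vertices lie outside `S`. -/
lemma card_edgeFinset_lt_of_cliqueFree_four {k : ℕ} (hk : 12 ≤ k) (hG : G.CliqueFree 4)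
    {S : Finset V} (hS : S.card = k) (hdeg : ∀ v ∈ S, G.degree v ≤ k)
    (hm : Sᶜ.card = k + 1 ∨ Sᶜ.card = k + 2) :
    G.edgeFinset.card < (turanGraph (Sᶜ.card + (k - 1)) 3).edgeFinset.card + 1 := by
  have hne : S.Nonempty := Finset.card_pos.1 (by omega)
  -- With a the largest number of neighbours outside S, a ≤ k: if a is near k, the triangle-free
  -- neighbourhood makes Sᶜ sparse (`h3`); otherwise few edges leave S (`h1`) and Turán's bound on
  -- Sᶜ suffices. The case a = k, |Sᶜ| = k + 1 is what needs k ≥ 12.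
  obtain ⟨v, hv, hmax⟩ := Finset.exists_max_image S (G.degIn Sᶜ) hne
  have h1 := two_mul_card_edgeFinset_le hdeg hmax
  have h2 := degSum_le_turan (r := 3) (by norm_num) (cliqueFree_induce hG (Sᶜ : Finset V))
  have h3 := two_mul_degSum_le_of_cliqueFree_four (Y := Sᶜ) (v := v) hG
  have h4 := mul_card_edgeFinset_turanGraph_le (n := Sᶜ.card) (r := 3)
  have h5 := sq_le_three_mul_card_edgeFinset_turanGraph (Sᶜ.card + (k - 1))
  have hak : G.degIn Sᶜ v ≤ k := (degIn_compl_le S v).trans (hdeg v hv)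
  rw [hS] at h1
  generalize (turanGraph (Sᶜ.card + (k - 1)) 3).edgeFinset.card = T at *
  generalize (turanGraph Sᶜ.card 3).edgeFinset.card = t at *
  generalize G.degSum Sᶜ = D at *
  generalize G.degIn Sᶜ v = a at *
  generalize G.edgeFinset.card = e at *
  rcases hm with hm | hm <;> rw [hm] at h3 h4 h5
  · rw [show k + 1 + (k - 1) = 2 * k by omega] at h5
    rcases (show a = k ∨ a = k - 1 ∨ a + 2 ≤ k by omega) with rfl | rfl | ha
    · rw [show a + 1 - a = 1 by omega, Nat.add_sub_cancel] at h3
      nlinarith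
    · obtain ⟨l, rfl⟩ := Nat.exists_eq_add_of_le' (show 1 ≤ k by omega)
      rw [Nat.add_sub_cancel, Nat.add_sub_cancel, show l + 1 + 1 - l = 2 by omega] at h3
      rw [Nat.add_sub_cancel] at h1
      nlinarith
    · nlinarith
  · rw [show k + 2 + (k - 1) = 2 * k + 1 by omega] at h5
    rcases (show a = k ∨ a + 1 ≤ k by omega) with rfl | ha
    · rw [show a + 2 - a = 2 by omega, show a + 2 - 1 = a + 1 by omega] at h3
      nlinarith
    · nlinarith

/-- The graphs attaining the bound, apart from the Turán graphs with a pendant vertex. -/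
def IsSporadicExtremal (G : SimpleGraph V) (n r : ℕ) : Prop :=
  (5 ≤ r ∧ n = 5 ∧ Nonempty (G ≃g multipartite ![3, 1, 1])) ∨
    (r = 4 ∧ n = 11 ∧ Nonempty (G ≃g multipartite ![6, 2, 2, 1])) ∨
    (r = 5 ∧ n = 7 ∧ Nonempty (G ≃g multipartite ![4, 1, 1, 1])) ∨
    (r = 5 ∧ n = 9 ∧ Nonempty (G ≃g multipartite ![5, 1, 1, 1, 1]))

/-- The k + 1 vertices of low degree split as S and one extra vertex w, which identifies the vertex
missed by all of S. -/
lemma isSporadicExtremal_of_card_edgeFinset_eq {r k : ℕ} (hr : 0 < r)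
    (hG : G.CliqueFree (r + 1)) (hV : Fintype.card V = 2 * k + 1)
    (hkr : (5 ≤ r ∧ k = 2) ∨ (r = 5 ∧ (k = 3 ∨ k = 4)) ∨ (r = 4 ∧ k = 5))
    (hlow : k + 1 ≤ (Finset.univ.filter fun v => G.degree v ≤ k).card)
    (heq : k ^ 2 + (turanGraph (k + 1) r).edgeFinset.card ≤ G.edgeFinset.card) :
    G.IsSporadicExtremal (2 * k + 1) r := by
  obtain ⟨I, hI, hIcard⟩ := Finset.exists_subset_card_eq hlow
  obtain ⟨w, hwI⟩ := Finset.card_pos.1 (show 0 < I.card by omega)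
  have hdegI : ∀ v ∈ I, G.degree v ≤ k := fun v hv => (Finset.mem_filter.1 (hI hv)).2
  have hS : (I.erase w).card = k := by
    rw [Finset.card_erase_of_mem hwI, hIcard, Nat.add_sub_cancel]
  have hw : w ∉ I.erase w := Finset.notMem_erase w I
  have hdegS : ∀ v ∈ I.erase w, G.degree v ≤ k := fun v hv => hdegI v (Finset.mem_of_mem_erase hv)
  have hwdeg := hdegI w hwI
  generalize I.erase w = S at *
  have hcard : Sᶜ.card = k + 1 := by
    rw [Finset.card_compl, hV, hS]
    omega
  obtain ⟨hdeg, hdegIn, ⟨φ⟩⟩ := degrees_eq_of_card_edgeFinset_eq hr hG hS hdegS (by rwa [hcard])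
  rw [hcard] at φ
  by_cases hkr' : k + 1 ≤ r
  · have hiso := nonempty_iso_multipartite_of_iso_turanGraph_of_le hkr' hw hS hcard hdeg hdegIn
      hwdeg φ
    rcases hkr with ⟨h5, rfl⟩ | ⟨rfl, rfl | rfl⟩ | ⟨rfl, rfl⟩
    · rw [show (Fin.cons (2 + 1) fun _ : Fin 2 => 1 : Fin 3 → ℕ) = ![3, 1, 1] by decide] at hiso
      exact Or.inl ⟨h5, rfl, hiso⟩
    · rw [show (Fin.cons (3 + 1) fun _ : Fin 3 => 1 : Fin 4 → ℕ) = ![4, 1, 1, 1] by decide]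
        at hiso
      exact Or.inr (Or.inr (Or.inl ⟨rfl, rfl, hiso⟩))
    · rw [show (Fin.cons (4 + 1) fun _ : Fin 4 => 1 : Fin 5 → ℕ) = ![5, 1, 1, 1, 1] by decide]
        at hiso
      exact Or.inr (Or.inr (Or.inr ⟨rfl, rfl, hiso⟩))
    · omega
  · obtain ⟨rfl, rfl⟩ : r = 4 ∧ k = 5 := by omega
    exact Or.inr (Or.inl ⟨rfl, rfl, nonempty_iso_multipartite_of_iso_turanGraph_six_four hG hw hS
      hcard hdeg hdegIn hwdeg φ⟩)

/-- The count with S = {u} and k = 1, where k² + e(T_r(n-k)) is the claimed bound itself. -/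
lemma card_edgeFinset_of_degree_le_one {r : ℕ} (hr : 0 < r) (hG : G.CliqueFree (r + 1)) {u : V}
    (hu : G.degree u ≤ 1) :
    G.edgeFinset.card < (turanGraph (Fintype.card V - 1) r).edgeFinset.card + 1 ∨
      G.edgeFinset.card = (turanGraph (Fintype.card V - 1) r).edgeFinset.card + 1 ∧
        IsTuranPlusVertex G r 1 := by
  have hcard : ({u}ᶜ : Finset V).card = Fintype.card V - 1 := by
    rw [Finset.card_compl, Finset.card_singleton]
  have hdeg : ∀ v ∈ ({u} : Finset V), G.degree v ≤ 1 := by simpa using hu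
  have hle := card_edgeFinset_le_sq_add hr hG (Finset.card_singleton u) hdeg
  rw [hcard, one_pow, add_comm] at hle
  rcases hle.lt_or_eq with hlt | heq
  · exact Or.inl hlt
  · refine Or.inr ⟨heq, hG, u, ?_⟩
    obtain ⟨h1, -, h2⟩ := degrees_eq_of_card_edgeFinset_eq hr hG (Finset.card_singleton u) hdeg
      (by rw [hcard, heq]; omega)
    refine ⟨h1 u (Finset.mem_singleton_self u), ?_⟩
    rw [hcard] at h2
    have hset : {v : V | v ≠ u} = (({u}ᶜ : Finset V) : Set V) := by
      ext
      simp
    rwa [hset]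

/-- The bound, with the list of graphs attaining it. -/
theorem card_edgeFinset_of_not_hasHamiltonianCycle {r n : ℕ} (hV : Fintype.card V = n)
    (hr : 3 ≤ r) (hn : (if r = 3 then 26 else if r = 4 then 11 else 1) ≤ n)
    (hG : G.CliqueFree (r + 1)) (hham : ¬ HasHamiltonianCycle G) :
    G.edgeFinset.card < (turanGraph (n - 1) r).edgeFinset.card + 1 ∨
      G.edgeFinset.card = (turanGraph (n - 1) r).edgeFinset.card + 1 ∧
        (IsTuranPlusVertex G r 1 ∨ G.IsSporadicExtremal n r) := by
  have hlow : (∃ u, G.degree u ≤ 1) →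
      G.edgeFinset.card < (turanGraph (n - 1) r).edgeFinset.card + 1 ∨
      G.edgeFinset.card = (turanGraph (n - 1) r).edgeFinset.card + 1 ∧
        (IsTuranPlusVertex G r 1 ∨ G.IsSporadicExtremal n r) := by
    rintro ⟨u, hu⟩
    rw [← hV]
    exact (card_edgeFinset_of_degree_le_one (by omega) hG hu).imp_right
      fun h => ⟨h.1, Or.inl h.2⟩
  have hn1 : 1 ≤ n := le_trans (by split_ifs <;> norm_num) hn
  rcases lt_or_ge n 3 with h3 | h3
  · obtain ⟨u⟩ : Nonempty V := Fintype.card_pos_iff.1 (by omega)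
    have := G.degree_lt_card_verts u
    exact hlow ⟨u, by omega⟩
  obtain ⟨k, hk, hk1, hk2, u, hu⟩ :=
    exists_degree_condition_of_not_hasHamiltonianCycle (hV ▸ h3) hham
  rw [hV] at hk hk2
  rcases lt_or_ge k 2 with hk' | hk'
  · exact hlow ⟨u, by omega⟩
  clear hlow u hu
  obtain ⟨S, hS, hScard⟩ := Finset.exists_subset_card_eq hk1
  have hdeg : ∀ v ∈ S, G.degree v ≤ k := fun v hv => (Finset.mem_filter.1 (hS hv)).2
  have hcompl : Sᶜ.card = n - k := by rw [Finset.card_compl, hV, hScard]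
  have hle := card_edgeFinset_le_sq_add (by omega) hG hScard hdeg
  have hsporadic : k ^ 2 + (turanGraph Sᶜ.card r).edgeFinset.card =
        (turanGraph (Sᶜ.card + (k - 1)) r).edgeFinset.card + 1 → Sᶜ.card = k + 1 →
      (5 ≤ r ∧ k = 2) ∨ (r = 5 ∧ (k = 3 ∨ k = 4)) ∨ (r = 4 ∧ k = 5) →
      G.edgeFinset.card < (turanGraph (n - 1) r).edgeFinset.card + 1 ∨
      G.edgeFinset.card = (turanGraph (n - 1) r).edgeFinset.card + 1 ∧
        (IsTuranPlusVertex G r 1 ∨ G.IsSporadicExtremal n r) := by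
    intro heq hk1 hkr
    rw [show Sᶜ.card + (k - 1) = n - 1 by omega] at heq
    rcases (heq ▸ hle).lt_or_eq with h | h
    · exact Or.inl h
    · refine Or.inr ⟨h, Or.inr ?_⟩
      obtain rfl : n = 2 * k + 1 := by omega
      refine isSporadicExtremal_of_card_edgeFinset_eq (by omega) hG hV hkr ?_ ?_
      -- Since n - k = k + 1, degree < n - k means degree ≤ k: Chvátal's second inequality supplies
      -- the extra vertex.
      · rw [show 2 * k + 1 - k = k + 1 by omega] at hk2
        simpa only [Nat.lt_succ_iff] using hk2
      · rw [← hk1, heq, h]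
  have hn' : Sᶜ.card + (k - 1) = n - 1 := by omega
  rcases (show r = 3 ∨ r = 4 ∨ 5 ≤ r by omega) with rfl | rfl | h5
  · left
    rw [if_pos rfl] at hn
    rw [← hn']
    rcases (show (Sᶜ.card = k + 1 ∨ Sᶜ.card = k + 2) ∨ k + 3 ≤ Sᶜ.card by omega) with hm | hm
    · exact card_edgeFinset_lt_of_cliqueFree_four (by omega) hG hScard hdeg hm
    · exact hle.trans_lt (sq_add_card_edgeFinset_turanGraph_lt_of_eq_three hk' hm)
  · norm_num at hn
    rcases sq_add_card_edgeFinset_turanGraph_le_of_eq_four (m := Sᶜ.card) hk' (by omega)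
      (by omega) with h | ⟨h, h6, rfl⟩
    · rw [← hn']
      exact Or.inl (hle.trans_lt h)
    · exact hsporadic h h6 (by omega)
  · rcases sq_add_card_edgeFinset_turanGraph_le_of_five_le h5 (m := Sᶜ.card) hk' (by omega)
      with h | ⟨h, hm, hkr⟩
    · rw [← hn']
      exact Or.inl (hle.trans_lt h)
    · exact hsporadic h hm (by omega)

end Bound

/-! ### The listed graphs attain the bound -/

section Converse

variable {V : Type*} [Fintype V] [DecidableEq V] {G : SimpleGraph V} [DecidableRel G.Adj]

lemma card_edgeFinset_of_isTuranPlusVertex {r : ℕ} (h : IsTuranPlusVertex G r 1) :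
    ¬ HasHamiltonianCycle G ∧
      G.edgeFinset.card = (turanGraph (Fintype.card V - 1) r).edgeFinset.card + 1 := by
  obtain ⟨-, x, hx, hiso⟩ := h
  refine ⟨not_hasHamiltonianCycle_of_degree_eq_one hx, ?_⟩
  have hset : {v : V | v ≠ x} = (({x}ᶜ : Finset V) : Set V) := by
    ext
    simp
  rw [hset] at hiso
  have h1 := degSum_eq_of_iso_turanGraph hiso
  have h2 := two_mul_card_edgeFinset_eq (G := G) {x}
  have h3 : G.degIn {x} x < 1 := degIn_lt_card (Finset.mem_singleton_self x)
  have h4 := G.degIn_add_degIn_compl {x} x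
  rw [Finset.sum_singleton] at h2
  omega

lemma card_edgeFinset_of_isSporadicExtremal {n r : ℕ} (h : G.IsSporadicExtremal n r) :
    G.CliqueFree (r + 1) ∧ ¬ HasHamiltonianCycle G ∧
      G.edgeFinset.card = (turanGraph (n - 1) r).edgeFinset.card + 1 := by
  rcases h with ⟨h5, rfl, ⟨e⟩⟩ | ⟨rfl, rfl, ⟨e⟩⟩ | ⟨rfl, rfl, ⟨e⟩⟩ | ⟨rfl, rfl, ⟨e⟩⟩
  all_goals
    have hcard := card_eq_of_iso_multipartite e
    have hedges := two_mul_card_edgeFinset_of_iso_multipartite e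
    simp only [Fin.sum_univ_succ, Fin.isValue, Matrix.cons_val_zero, Matrix.cons_val_succ,
      Finset.univ_eq_empty, Finset.sum_empty] at hcard hedges
    refine ⟨cliqueFree_of_iso_multipartite e (by omega),
      not_hasHamiltonianCycle_of_iso_multipartite e 0 (by rw [hcard]; decide), ?_⟩
    rw [hcard] at hedges
  · have htop : (turanGraph 4 r).edgeFinset.card = 6 := by
      have h : ∀ j, (turanGraph (j + 1) r).edgeFinset.card = _ :=
        card_edgeFinset_turanGraph_succ (show 0 < r by omega)
      rw [h 3, h 2, h 1, h 0, card_edgeFinset_turanGraph_zero, Nat.div_eq_of_lt (by omega),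
        Nat.div_eq_of_lt (by omega), Nat.div_eq_of_lt (by omega), Nat.div_eq_of_lt (by omega)]
    rw [htop]
    omega
  · have ht : (turanGraph 10 4).edgeFinset.card = 37 := by
      simp [card_edgeFinset_turanGraph, Nat.choose]
    rw [ht]
    omega
  · have ht : (turanGraph 6 5).edgeFinset.card = 14 := by
      simp [card_edgeFinset_turanGraph, Nat.choose]
    rw [ht]
    omega
  · have ht : (turanGraph 8 5).edgeFinset.card = 25 := by
      simp [card_edgeFinset_turanGraph, Nat.choose]
    rw [ht]
    omega

end Converse

end SimpleGraph

theorem mainTheorem1 {V : Type*} [Fintype V] [DecidableEq V]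
    (G : SimpleGraph V) [DecidableRel G.Adj] (n r : ℕ)
    (hV : Fintype.card V = n) (hr : 3 ≤ r)
    (hn : (if r = 3 then 26 else if r = 4 then 11 else 1) ≤ n) :
    (G.CliqueFree (r + 1) → ¬ HasHamiltonianCycle G →
      G.edgeFinset.card ≤ (SimpleGraph.turanGraph (n - 1) r).edgeFinset.card + 1) ∧
    ((G.CliqueFree (r + 1) ∧ ¬ HasHamiltonianCycle G ∧
        G.edgeFinset.card = (SimpleGraph.turanGraph (n - 1) r).edgeFinset.card + 1) ↔
      (IsTuranPlusVertex G r 1 ∨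
        (5 ≤ r ∧ n = 5 ∧ Nonempty (G ≃g multipartite ![3, 1, 1])) ∨
        (r = 4 ∧ n = 11 ∧ Nonempty (G ≃g multipartite ![6, 2, 2, 1])) ∨
        (r = 5 ∧ n = 7 ∧ Nonempty (G ≃g multipartite ![4, 1, 1, 1])) ∨
        (r = 5 ∧ n = 9 ∧ Nonempty (G ≃g multipartite ![5, 1, 1, 1, 1])))) := by
  have key := fun hG hham =>
    SimpleGraph.card_edgeFinset_of_not_hasHamiltonianCycle (G := G) hV hr hn hG hham
  refine ⟨fun hG hham => ?_, fun ⟨hG, hham, heq⟩ => ?_, fun h => ?_⟩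
  · rcases key hG hham with h | h
    · exact h.le
    · exact h.1.le
  · rcases key hG hham with h | h
    · exact absurd heq h.ne
    · exact h.2
  · rcases h with h | h
    · subst hV
      exact ⟨h.1, SimpleGraph.card_edgeFinset_of_isTuranPlusVertex h⟩
    · exact SimpleGraph.card_edgeFinset_of_isSporadicExtremal h
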